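/- Let $(V,E,c)$ be a connected network: $V$ is a countable set, $E\subset V\times V$ is a symmetric relation without loops such that every $x\in V$ has finitely many, and at least one, neighbours $y\sim x$ (i.e. $(x,y)\in E$), the graph is connected, and $c_{xy}=c_{yx}>0$ for $(x,y)\in E$. Let $\mathscr H_E$ be the Hilbert space of functions $u:V\to\mathbb C$, modulo constants, with finite energy $\|u\|_{\mathscr H_E}^2=\frac12\sum_{(x,y)\in E}c_{xy}|u(x)-u(y)|^2<\infty$, with inner product $\langle u,v\rangle_{\mathscr H_E}=\frac12\sum_{(x,y)\in E}c_{xy}\overline{(u(x)-u(y))}(v(x)-v(y))$, and let $(\Delta u)(x)=\sum_{y\sim x}c_{xy}(u(x)-u(y))$. Fix $o\in V$, put $V'=V\setminus\{o\}$, let $v_x\in\mathscr H_E$ ($x\in V'$) be the dipole determined by $\langle v_x,u\rangle_{\mathscr H_E}=u(x)-u(o)$ for all $u\in\mathscr H_E$, and let $\mathscr D_E$ be the space of finite linear combinations of the $v_x$, $x\in V'$. The operator $\Delta$ with domain $\mathscr D_E$ is densely defined, symmetric and nonnegative in $\mathscr H_E$; let $\Delta_{Fri}$ be its Friedrichs extension,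 i.e. the operator associated with the closure of the quadratic form $\varphi\mapsto\langle\varphi,\Delta\varphi\rangle_{\mathscr H_E}$ on $\mathscr D_E$. A function $u:V\to\mathbb C$ is in the domain of $\Delta_{Fri}$ (that is, it has finite energy and its class in $\mathscr H_E$ lies in that domain) if and only if the following two conditions hold: 1. $u$ is in the completion of $\mathscr D_E$ with respect to the quadratic form $\varphi\mapsto\langle\varphi,\Delta\varphi\rangle_{\mathscr H_E}$, taken inside $\mathscr H_E$: $u$ has finite energy and there are $\varphi_n\in\mathscr D_E$ with $\varphi_n\to u$ in $\mathscr H_E$ and $\langle\varphi_n-\varphi_m,\Delta(\varphi_n-\varphi_m)\rangle_{\mathscr H_E}\to0$ as $n,m\to\infty$; 2. $\Delta u\in\mathscr H_E$, i.e. the function $\Delta u$ has finite energy. Moreover, for every finite sum $\varphi=\sum_{x\in V'}\xi_xv_x$ one has $\langle\varphi,\Delta\varphi\rangle_{\mathscr H_E}=\sum_{x\in V'}|\xi_x|^2+\bigl|\sum_{x\in V'}\xi_x\bigr|^2$; in particular $\langle\varphi,\Delta\varphi\rangle_{\mathscr H_E}=\sum_{x\in V'}|\xi_x|^2$ when $\sum_{x\in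 V'}\xi_x=0$. -/

import Mathlib

open Filter Topology

noncomputable section

/-! ### The Friedrichs extension of a nonnegative symmetric operator -/

section Friedrichs

variable {H : Type*} [NormedAddCommGroup H] [InnerProductSpace ℂ H]

/-- `S` is densely defined, symmetric and nonnegative. -/
structure IsNonnegSymmetric (S : H →ₗ.[ℂ] H) : Prop where
  dense : Dense (S.domain : Set H)
  symm : ∀ φ ψ : S.domain, inner ℂ (S φ) (ψ : H) = inner ℂ (φ : H) (S ψ)
  nonneg : ∀ φ : S.domain, 0 ≤ (inner ℂ (φ : H) (S φ)).re

/-- The sequence `φ_n` in the domain of `S` converges to `u` in `H` and is a Cauchy sequence for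
the quadratic form `φ ↦ ⟨φ, Sφ⟩`. -/
def FormConverges (S : H →ₗ.[ℂ] H) (φ : ℕ → S.domain) (u : H) : Prop :=
  Tendsto (fun n => (φ n : H)) atTop (𝓝 u) ∧
    Tendsto (fun p : ℕ × ℕ =>
      (inner ℂ ((φ p.1 - φ p.2 : S.domain) : H) (S (φ p.1 - φ p.2))).re) atTop (𝓝 0)

/-- The completion, inside `H`, of the domain of `S` with respect to the quadratic form
`φ ↦ ⟨φ, Sφ⟩` (together with the norm of `H`): the domain of the closure of the form. -/
def formDomain (S : H →ₗ.[ℂ] H) : Set H :=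
  {u | ∃ φ : ℕ → S.domain, FormConverges S φ u}

theorem FormConverges.const (S : H →ₗ.[ℂ] H) (φ : S.domain) :
    FormConverges S (fun _ => φ) (φ : H) := by
  refine ⟨tendsto_const_nhds, ?_⟩
  simp

theorem FormConverges.smul {S : H →ₗ.[ℂ] H} {φ : ℕ → S.domain} {u : H}
    (h : FormConverges S φ u) (a : ℂ) : FormConverges S (fun n => a • φ n) (a • u) := by
  refine ⟨h.1.const_smul a, ?_⟩
  have := h.2.const_mul (‖a‖ ^ 2)
  rw [mul_zero] at this
  refine this.congr fun p => ?_
  rw [← smul_sub, LinearPMap.map_smul, Submodule.coe_smul, inner_smul_left, inner_smul_right,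
    ← mul_assoc, Complex.conj_mul', ← Complex.ofReal_pow, Complex.re_ofReal_mul]

theorem FormConverges.add {S : H →ₗ.[ℂ] H} (hS : IsNonnegSymmetric S) {φ ψ : ℕ → S.domain}
    {u v : H} (hu : FormConverges S φ u) (hv : FormConverges S ψ v) :
    FormConverges S (fun n => φ n + ψ n) (u + v) := by
  refine ⟨hu.1.add hv.1, ?_⟩
  have h2 := (hu.2.add hv.2).const_mul 2
  rw [add_zero, mul_zero] at h2
  refine squeeze_zero (fun p => hS.nonneg _) (fun p => ?_) h2
  have key : ∀ a b : S.domain, (inner ℂ ((a + b : S.domain) : H) (S (a + b))).re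
      ≤ 2 * ((inner ℂ (a : H) (S a)).re + (inner ℂ (b : H) (S b)).re) := by
    intro a b
    have h := hS.nonneg (a - b)
    simp only [LinearPMap.map_sub, LinearPMap.map_add, Submodule.coe_sub, Submodule.coe_add,
      inner_sub_left, inner_sub_right, inner_add_left, inner_add_right, Complex.add_re,
      Complex.sub_re] at h ⊢
    linarith
  rw [show φ p.1 + ψ p.1 - (φ p.2 + ψ p.2) = (φ p.1 - φ p.2) + (ψ p.1 - ψ p.2) by abel]
  exact key _ _

/-- The graph of the operator associated with the closure `q` of the form `⟨φ, Sψ⟩`: the pairs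
`(u, w)` such that `u` is in the domain of `q` and `q(u, v) = ⟨w, v⟩` for all `v` in the domain
of `q`, where `q(u, v)` is the limit of `⟨φ_n, Sψ_n⟩` along sequences `φ_n` and `ψ_n` that converge
to `u` and `v` in the sense of the form. -/
def friedrichsGraph (S : H →ₗ.[ℂ] H) (hS : IsNonnegSymmetric S) : Submodule ℂ (H × H) where
  carrier := {p | ∃ φ, FormConverges S φ p.1 ∧ ∀ v ψ, FormConverges S ψ v →
    Tendsto (fun n => inner ℂ (φ n : H) (S (ψ n))) atTop (𝓝 (inner ℂ p.2 v))}
  zero_mem' := ⟨fun _ => 0, FormConverges.const S 0, fun v ψ _ => by simp⟩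
  add_mem' := by
    rintro p r ⟨φ, hφ, hp⟩ ⟨χ, hχ, hr⟩
    refine ⟨fun n => φ n + χ n, hφ.add hS hχ, fun v ψ hψ => ?_⟩
    simp only [Submodule.coe_add, Prod.snd_add, inner_add_left]
    exact (hp v ψ hψ).add (hr v ψ hψ)
  smul_mem' := by
    rintro a p ⟨φ, hφ, hp⟩
    refine ⟨fun n => a • φ n, hφ.smul a, fun v ψ hψ => ?_⟩
    simp only [Submodule.coe_smul, Prod.smul_snd, inner_smul_left]
    exact (hp v ψ hψ).const_mul _

/-- The Friedrichs extension of a densely defined nonnegative symmetric operator `S`: the operator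
associated with the closure of the quadratic form of `S`. -/
def friedrichs (S : H →ₗ.[ℂ] H) (hS : IsNonnegSymmetric S) : H →ₗ.[ℂ] H :=
  (friedrichsGraph S hS).toLinearPMap

/-- The graph above is single-valued, hence it is the graph of the operator. -/
theorem friedrichs_graph (S : H →ₗ.[ℂ] H) (hS : IsNonnegSymmetric S) :
    (friedrichs S hS).graph = friedrichsGraph S hS := by
  refine Submodule.toLinearPMap_graph_eq _ ?_
  rintro ⟨u, w⟩ ⟨φ, hφ, h⟩ rfl
  refine hS.dense.eq_zero_of_inner_left (𝕜 := ℂ) fun v hv => ?_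
  lift v to S.domain using hv
  have h1 := h v (fun _ => v) (FormConverges.const S v)
  have h2 := hφ.1.inner (𝕜 := ℂ) (tendsto_const_nhds (x := S v))
  have := tendsto_nhds_unique h1 h2
  simpa using this

end Friedrichs

/-! ### Networks and the energy form -/

/-- A connected network `(V, E, c)`: a symmetric loop-free edge relation in which every vertex has
finitely many neighbours and at least one, which is connected, together with a conductance
function. The conductance is extended by `0` to the pairs that are not edges. -/
structure Network (V : Type*) where
  graph : SimpleGraph V
  finite_nbrs : ∀ x, (graph.neighborSet x).Finite
  exists_nbr : ∀ x, (graph.neighborSet x).Nonempty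
  connected : graph.Connected
  c : V → V → ℝ
  c_symm : ∀ x y, c x y = c y x
  c_pos : ∀ x y, graph.Adj x y → 0 < c x y
  c_off : ∀ x y, ¬ graph.Adj x y → c x y = 0

namespace Network

variable {V : Type*} (N : Network V)

theorem c_nonneg (x y : V) : 0 ≤ N.c x y := by
  by_cases h : N.graph.Adj x y
  · exact (N.c_pos x y h).le
  · exact (N.c_off x y h).ge

/-- The finite set `E(x)` of neighbours of `x`. -/
def nbrs (x : V) : Finset V := (N.finite_nbrs x).toFinset

/-- The graph Laplacian `(Δu)(x) = ∑_{y ∼ x} c_{xy} (u(x) - u(y))` on all functions on `V`. -/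
def lap : (V → ℂ) →ₗ[ℂ] (V → ℂ) where
  toFun u x := ∑ y ∈ N.nbrs x, (N.c x y : ℂ) * (u x - u y)
  map_add' u v := by
    funext x
    simp only [Pi.add_apply, ← Finset.sum_add_distrib]
    exact Finset.sum_congr rfl fun y _ => by ring
  map_smul' a u := by
    funext x
    simp only [Pi.smul_apply, smul_eq_mul, RingHom.id_apply, Finset.mul_sum]
    exact Finset.sum_congr rfl fun y _ => by ring

/-- The term of the energy form at the pair `p = (x, y)`. -/
def term (u v : V → ℂ) (p : V × V) : ℂ :=
  (N.c p.1 p.2 : ℂ) * (starRingEnd ℂ (u p.1 - u p.2) * (v p.1 - v p.2))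

theorem norm_term_le (u v : V → ℂ) (p : V × V) :
    ‖N.term u v p‖ ≤ N.c p.1 p.2 * ‖u p.1 - u p.2‖ ^ 2 + N.c p.1 p.2 * ‖v p.1 - v p.2‖ ^ 2 := by
  have h : ‖N.term u v p‖ = N.c p.1 p.2 * (‖u p.1 - u p.2‖ * ‖v p.1 - v p.2‖) := by
    simp only [term, norm_mul, Complex.norm_real, RCLike.norm_conj,
      Real.norm_of_nonneg (N.c_nonneg p.1 p.2)]
  rw [h, ← mul_add]
  refine mul_le_mul_of_nonneg_left ?_ (N.c_nonneg _ _)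
  nlinarith [sq_nonneg (‖u p.1 - u p.2‖ - ‖v p.1 - v p.2‖), sq_nonneg (‖u p.1 - u p.2‖),
    sq_nonneg (‖v p.1 - v p.2‖)]

/-- The functions `u : V → ℂ` of finite energy, `∑ c_{xy} |u(x) - u(y)|² < ∞`. -/
def finiteEnergy : Submodule ℂ (V → ℂ) where
  carrier := {u | Summable fun p : V × V => N.c p.1 p.2 * ‖u p.1 - u p.2‖ ^ 2}
  zero_mem' := by simp [summable_zero]
  add_mem' {u v} hu hv := by
    refine Summable.of_nonneg_of_le (fun p => mul_nonneg (N.c_nonneg _ _) (sq_nonneg _))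
      (fun p => ?_) ((Summable.add hu hv).mul_left 2)
    have h1 : ‖(u + v) p.1 - (u + v) p.2‖ ≤ ‖u p.1 - u p.2‖ + ‖v p.1 - v p.2‖ := by
      have : (u + v) p.1 - (u + v) p.2 = (u p.1 - u p.2) + (v p.1 - v p.2) := by
        simp only [Pi.add_apply]; ring
      rw [this]; exact norm_add_le _ _
    have h2 : ‖(u + v) p.1 - (u + v) p.2‖ ^ 2
        ≤ 2 * (‖u p.1 - u p.2‖ ^ 2 + ‖v p.1 - v p.2‖ ^ 2) := by
      nlinarith [norm_nonneg ((u + v) p.1 - (u + v) p.2),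
        sq_nonneg (‖u p.1 - u p.2‖ - ‖v p.1 - v p.2‖)]
    calc _ ≤ N.c p.1 p.2 * (2 * (‖u p.1 - u p.2‖ ^ 2 + ‖v p.1 - v p.2‖ ^ 2)) :=
          mul_le_mul_of_nonneg_left h2 (N.c_nonneg _ _)
      _ = _ := by ring
  smul_mem' a u hu := by
    refine (Summable.mul_left (‖a‖ ^ 2) hu).congr fun p => ?_
    simp only [Pi.smul_apply, smul_eq_mul, ← mul_sub, norm_mul]
    ring

theorem mem_finiteEnergy {u : V → ℂ} : u ∈ N.finiteEnergy ↔
    Summable fun p : V × V => N.c p.1 p.2 * ‖u p.1 - u p.2‖ ^ 2 := Iff.rfl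

theorem summable_term {u v : V → ℂ} (hu : u ∈ N.finiteEnergy) (hv : v ∈ N.finiteEnergy) :
    Summable (N.term u v) :=
  Summable.of_norm_bounded (Summable.add hu hv) (N.norm_term_le u v)

theorem term_self (u : V → ℂ) (p : V × V) :
    N.term u u p = ((N.c p.1 p.2 * ‖u p.1 - u p.2‖ ^ 2 : ℝ) : ℂ) := by
  simp only [term, Complex.conj_mul']
  push_cast
  rfl

/-- The vector space of functions of finite energy, as a type of its own: it carries the topology
of the energy seminorm, not that of pointwise convergence. -/
def EnergyFun : Type _ := N.finiteEnergy

instance : AddCommGroup N.EnergyFun := inferInstanceAs (AddCommGroup N.finiteEnergy)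

instance : Module ℂ N.EnergyFun := inferInstanceAs (Module ℂ N.finiteEnergy)

/-- A function of finite energy as an element of `EnergyFun`. -/
def toEnergyFun : N.finiteEnergy ≃ₗ[ℂ] N.EnergyFun := LinearEquiv.refl ℂ N.finiteEnergy

variable {N} in
/-- The underlying function on `V`. -/
def EnergyFun.fn (u : N.EnergyFun) : V → ℂ := (N.toEnergyFun.symm u).1

variable {N} in
theorem EnergyFun.fn_mem (u : N.EnergyFun) : u.fn ∈ N.finiteEnergy := (N.toEnergyFun.symm u).2

variable {N} in
theorem EnergyFun.fn_add (u v : N.EnergyFun) : (u + v).fn = u.fn + v.fn := rfl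

variable {N} in
theorem EnergyFun.fn_smul (a : ℂ) (u : N.EnergyFun) : (a • u).fn = a • u.fn := rfl

theorem fn_toEnergyFun (u : N.finiteEnergy) : (N.toEnergyFun u).fn = u.1 := rfl

/-- The energy form `½ ∑_{(x,y) ∈ E} c_{xy} conj(u(x) - u(y)) (v(x) - v(y))`, conjugate linear in
the first variable. -/
abbrev energyCore : PreInnerProductSpace.Core ℂ N.EnergyFun where
  inner u v := (1 / 2 : ℂ) * ∑' p : V × V, N.term u.fn v.fn p
  conj_inner_symm u v := by
    rw [map_mul, Complex.conj_tsum]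
    congr 1
    · simp [Complex.conj_ofNat]
    · refine tsum_congr fun p => ?_
      simp only [term, map_mul, Complex.conj_conj, Complex.conj_ofReal]
      ring
  re_inner_nonneg u := by
    have h : (∑' p : V × V, N.term u.fn u.fn p)
        = ((∑' p : V × V, N.c p.1 p.2 * ‖u.fn p.1 - u.fn p.2‖ ^ 2 : ℝ) : ℂ) := by
      rw [Complex.ofReal_tsum]
      exact tsum_congr fun p => N.term_self u.fn p
    have h2 : (0 : ℝ) ≤ ∑' p : V × V, N.c p.1 p.2 * ‖u.fn p.1 - u.fn p.2‖ ^ 2 :=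
      tsum_nonneg fun p => mul_nonneg (N.c_nonneg _ _) (sq_nonneg _)
    rw [h]
    have h3 : (1 / 2 : ℂ) = ((1 / 2 : ℝ) : ℂ) := by norm_num
    rw [h3, ← Complex.ofReal_mul]
    simp only [RCLike.re_to_complex, Complex.ofReal_re]
    positivity
  add_left u v w := by
    rw [← mul_add, ← (N.summable_term u.fn_mem w.fn_mem).tsum_add (N.summable_term v.fn_mem w.fn_mem)]
    congr 1
    refine tsum_congr fun p => ?_
    simp only [term, EnergyFun.fn_add, Pi.add_apply, map_sub, map_add]
    ring
  smul_left u v a := by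
    rw [mul_left_comm]
    congr 1
    rw [← tsum_mul_left]
    refine tsum_congr fun p => ?_
    simp only [term, EnergyFun.fn_smul, Pi.smul_apply, smul_eq_mul, map_sub, map_mul]
    ring

instance : SeminormedAddCommGroup N.EnergyFun :=
  @InnerProductSpace.Core.toSeminormedAddCommGroup ℂ _ _ _ _ N.energyCore

instance : InnerProductSpace ℂ N.EnergyFun := InnerProductSpace.ofCore N.energyCore

theorem inner_def (u v : N.EnergyFun) :
    inner ℂ u v = (1 / 2 : ℂ) * ∑' p : V × V, N.term u.fn v.fn p := rfl

theorem norm_sq_eq (u : N.EnergyFun) : ‖u‖ ^ 2 =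
    1 / 2 * ∑' p : V × V, N.c p.1 p.2 * ‖u.fn p.1 - u.fn p.2‖ ^ 2 := by
  have h1 : (∑' p : V × V, N.term u.fn u.fn p)
      = ((∑' p : V × V, N.c p.1 p.2 * ‖u.fn p.1 - u.fn p.2‖ ^ 2 : ℝ) : ℂ) := by
    rw [Complex.ofReal_tsum]
    exact tsum_congr fun p => N.term_self u.fn p
  have h3 : (1 / 2 : ℂ) = ((1 / 2 : ℝ) : ℂ) := by norm_num
  rw [@norm_sq_eq_re_inner ℂ, inner_def, h1, h3, ← Complex.ofReal_mul]
  rfl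

/-- The energy space `H_E`: functions of finite energy with the energy inner product, two functions
being identified when their difference has zero energy, that is (by connectedness), when it is
constant. -/
abbrev HE : Type _ := SeparationQuotient N.EnergyFun

/-- The vector of `H_E` given by a function of finite energy. -/
def toHE : N.finiteEnergy →ₗ[ℂ] N.HE :=
  (SeparationQuotient.mkCLM ℂ N.EnergyFun).toLinearMap ∘ₗ N.toEnergyFun.toLinearMap

theorem inner_toHE (u v : N.finiteEnergy) :
    inner ℂ (N.toHE u) (N.toHE v) = (1 / 2 : ℂ) * ∑' p : V × V, N.term u.1 v.1 p := rfl

theorem toHE_surjective : Function.Surjective N.toHE := fun f => by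
  obtain ⟨u, rfl⟩ := SeparationQuotient.surjective_mk f
  exact ⟨N.toEnergyFun.symm u, rfl⟩

/-! ### Completeness of the energy space -/

theorem norm_gradTerm_sq (u : V → ℂ) (p : V × V) :
    ‖((√(N.c p.1 p.2 / 2) : ℝ) : ℂ) * (u p.1 - u p.2)‖ ^ (2 : ℝ)
      = 1 / 2 * (N.c p.1 p.2 * ‖u p.1 - u p.2‖ ^ 2) := by
  have h : 0 ≤ N.c p.1 p.2 / 2 := div_nonneg (N.c_nonneg _ _) zero_le_two
  rw [Real.rpow_two, norm_mul, mul_pow, Complex.norm_real, Real.norm_of_nonneg (Real.sqrt_nonneg _),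
    Real.sq_sqrt h]
  ring

theorem memlp_iff (u : V → ℂ) :
    Memℓp (fun p : V × V => ((√(N.c p.1 p.2 / 2) : ℝ) : ℂ) * (u p.1 - u p.2)) 2
      ↔ u ∈ N.finiteEnergy := by
  rw [memℓp_gen_iff (by norm_num), mem_finiteEnergy]
  simp only [ENNReal.toReal_ofNat, norm_gradTerm_sq]
  exact summable_mul_left_iff (by norm_num)

/-- The gradient `u ↦ (√(c_{xy} / 2) (u(x) - u(y)))_{x, y}`, an isometry into `ℓ²(V × V)`. -/
def grad : N.EnergyFun →ₗᵢ[ℂ] lp (fun _ : V × V => ℂ) 2 where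
  toFun u := ⟨fun p => ((√(N.c p.1 p.2 / 2) : ℝ) : ℂ) * (u.fn p.1 - u.fn p.2),
    (N.memlp_iff u.fn).2 u.fn_mem⟩
  map_add' u v := by
    ext p
    simp only [EnergyFun.fn_add, Pi.add_apply, lp.coeFn_add]
    ring
  map_smul' a u := by
    ext p
    simp only [EnergyFun.fn_smul, Pi.smul_apply, lp.coeFn_smul, smul_eq_mul, RingHom.id_apply]
    ring
  norm_map' u := by
    refine (sq_eq_sq₀ (norm_nonneg _) (norm_nonneg _)).1 ?_
    have h := lp.norm_rpow_eq_tsum (p := 2) (by norm_num)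
      (⟨fun p => ((√(N.c p.1 p.2 / 2) : ℝ) : ℂ) * (u.fn p.1 - u.fn p.2),
        (N.memlp_iff u.fn).2 u.fn_mem⟩ : lp (fun _ : V × V => ℂ) 2)
    rw [ENNReal.toReal_ofNat, tsum_congr fun p => N.norm_gradTerm_sq u.fn p, tsum_mul_left,
      ← norm_sq_eq, Real.rpow_two] at h
    exact h

theorem grad_apply (u : N.EnergyFun) (p : V × V) :
    N.grad u p = ((√(N.c p.1 p.2 / 2) : ℝ) : ℂ) * (u.fn p.1 - u.fn p.2) := rfl

theorem sqrt_pos_of_adj {x y : V} (h : N.graph.Adj x y) : 0 < √(N.c x y / 2) :=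
  Real.sqrt_pos.2 (half_pos (N.c_pos x y h))

theorem reflTransGen (x y : V) : Relation.ReflTransGen N.graph.Adj x y :=
  (SimpleGraph.reachable_iff_reflTransGen x y).1 (N.connected.preconnected x y)

theorem isClosed_range_grad : IsClosed (Set.range N.grad) := by
  refine IsSeqClosed.isClosed fun g g0 hg hlim => ?_
  choose u hu using hg
  have hcoord : ∀ p : V × V, Tendsto (fun n => g n p) atTop (𝓝 (g0 p)) := by
    intro p
    rw [tendsto_iff_norm_sub_tendsto_zero] at hlim ⊢
    refine squeeze_zero (fun _ => norm_nonneg _) (fun n => ?_) hlim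
    have := lp.norm_apply_le_norm (p := 2) (by norm_num) (g n - g0) p
    simpa using this
  obtain ⟨o⟩ := N.connected.nonempty
  have hconv : ∀ x, ∃ l, Tendsto (fun n => (u n).fn x - (u n).fn o) atTop (𝓝 l) := by
    intro x
    induction N.reflTransGen o x with
    | refl => exact ⟨0, by simp⟩
    | @tail y z _ hyz ih =>
      obtain ⟨l, hl⟩ := ih
      have hs : ((√(N.c y z / 2) : ℝ) : ℂ) ≠ 0 :=
        Complex.ofReal_ne_zero.2 (N.sqrt_pos_of_adj hyz).ne'
      refine ⟨l - ((√(N.c y z / 2) : ℝ) : ℂ)⁻¹ * g0 (y, z),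
        (hl.sub ((hcoord (y, z)).const_mul (((√(N.c y z / 2) : ℝ) : ℂ)⁻¹))).congr fun n => ?_⟩
      rw [← hu n, grad_apply, inv_mul_cancel_left₀ hs]
      ring
  choose l hl using hconv
  have hg0 : ∀ p : V × V, g0 p = ((√(N.c p.1 p.2 / 2) : ℝ) : ℂ) * (l p.1 - l p.2) := by
    intro p
    refine tendsto_nhds_unique (hcoord p)
      ((((hl p.1).sub (hl p.2)).const_mul ((√(N.c p.1 p.2 / 2) : ℝ) : ℂ)).congr fun n => ?_)
    rw [← hu n, grad_apply]
    ring
  have hmem : l ∈ N.finiteEnergy := by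
    rw [← N.memlp_iff]
    have := lp.memℓp g0
    rwa [show (g0 : ∀ _ : V × V, ℂ) = _ from funext hg0] at this
  refine ⟨N.toEnergyFun ⟨l, hmem⟩, lp.ext (funext fun p => ?_)⟩
  rw [hg0 p, grad_apply, fn_toEnergyFun]

instance : CompleteSpace N.EnergyFun :=
  (completeSpace_iff_isComplete_range N.grad.isometry.isUniformInducing).2
    N.isClosed_range_grad.isComplete

/-! ### Dipoles -/

theorem exists_drop_bound (x y : V) :
    ∃ C : ℝ, ∀ u : N.EnergyFun, ‖u.fn x - u.fn y‖ ≤ C * ‖u‖ := by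
  induction N.reflTransGen x y with
  | refl => exact ⟨0, fun u => by simp⟩
  | @tail y z _ hyz ih =>
    obtain ⟨C, hC⟩ := ih
    refine ⟨C + (√(N.c y z / 2))⁻¹, fun u => ?_⟩
    have hs := N.sqrt_pos_of_adj hyz
    have h1 : √(N.c y z / 2) * ‖u.fn y - u.fn z‖ ≤ ‖u‖ := by
      have := lp.norm_apply_le_norm (p := 2) (by norm_num) (N.grad u) (y, z)
      rwa [grad_apply, norm_mul, Complex.norm_real, Real.norm_of_nonneg hs.le,
        N.grad.norm_map] at this
    have h2 : ‖u.fn y - u.fn z‖ ≤ (√(N.c y z / 2))⁻¹ * ‖u‖ := by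
      rw [inv_mul_eq_div, le_div_iff₀ hs]
      linarith
    calc ‖u.fn x - u.fn z‖ = ‖(u.fn x - u.fn y) + (u.fn y - u.fn z)‖ := by congr 1; ring
      _ ≤ ‖u.fn x - u.fn y‖ + ‖u.fn y - u.fn z‖ := norm_add_le _ _
      _ ≤ _ := by rw [add_mul]; exact add_le_add (hC u) h2

/-- The functional `u ↦ u(x) - u(y)` on functions of finite energy. -/
def dropFun (x y : V) : N.EnergyFun →L[ℂ] ℂ :=
  LinearMap.mkContinuousOfExistsBound
    { toFun := fun u => u.fn x - u.fn y
      map_add' := fun u v => by simp only [EnergyFun.fn_add, Pi.add_apply]; ring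
      map_smul' := fun a u => by
        simp only [EnergyFun.fn_smul, Pi.smul_apply, smul_eq_mul, RingHom.id_apply]; ring }
    (N.exists_drop_bound x y)

/-- The functional `u ↦ u(x) - u(y)` on `H_E`. -/
def drop (x y : V) : N.HE →L[ℂ] ℂ :=
  SeparationQuotient.liftCLM (N.dropFun x y) fun _ _ h => (h.map (N.dropFun x y).continuous).eq

theorem drop_toHE (x y : V) (u : N.finiteEnergy) : N.drop x y (N.toHE u) = u.1 x - u.1 y := rfl

/-- The dipole `v_{xy} ∈ H_E`, the unique vector with `⟨v_{xy}, u⟩ = u(x) - u(y)` for all `u`. -/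
def dipole (x y : V) : N.HE := (InnerProductSpace.toDual ℂ N.HE).symm (N.drop x y)

theorem inner_dipole (x y : V) (f : N.HE) : inner ℂ (N.dipole x y) f = N.drop x y f :=
  InnerProductSpace.toDual_symm_apply

/-! ### The Laplacian on the span of the dipoles -/

/-- The function `Δf` on `V` for `f ∈ H_E`; it depends only on the differences of `f`. -/
def lapHE : N.HE →ₗ[ℂ] (V → ℂ) where
  toFun f x := ∑ y ∈ N.nbrs x, (N.c x y : ℂ) * N.drop x y f
  map_add' f g := by
    funext x
    simp only [map_add, mul_add, Finset.sum_add_distrib, Pi.add_apply]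
  map_smul' a f := by
    funext x
    simp only [map_smul, smul_eq_mul, Pi.smul_apply, RingHom.id_apply, Finset.mul_sum]
    exact Finset.sum_congr rfl fun y _ => by ring

theorem lapHE_toHE (u : N.finiteEnergy) : N.lapHE (N.toHE u) = N.lap u.1 := rfl

theorem mem_nbrs {x y : V} : y ∈ N.nbrs x ↔ N.graph.Adj x y := by
  simp [nbrs]

open scoped Classical in
/-- The point mass `δ_x`. -/
def delta (x : V) : V → ℂ := fun y => if y = x then 1 else 0

open scoped Classical in
theorem term_delta_eq_zero (x : V) (p : V × V)
    (hp : p ∉ (N.nbrs x).image (fun y => (x, y)) ∪ (N.nbrs x).image (fun y => (y, x))) :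
    N.c p.1 p.2 = 0 ∨ delta x p.1 - delta x p.2 = 0 := by
  obtain ⟨a, b⟩ := p
  by_cases hab : N.graph.Adj a b
  · right
    simp only [Finset.mem_union, Finset.mem_image, mem_nbrs, Prod.mk.injEq, not_or, not_exists,
      not_and] at hp
    have ha : a ≠ x := by
      rintro rfl
      exact hp.1 b hab rfl rfl
    have hb : b ≠ x := by
      rintro rfl
      exact hp.2 a hab.symm rfl rfl
    simp [delta, ha, hb]
  · exact Or.inl (N.c_off a b hab)

theorem delta_mem (x : V) : delta x ∈ N.finiteEnergy := by
  classical
  refine summable_of_ne_finset_zero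
    (s := (N.nbrs x).image (fun y => (x, y)) ∪ (N.nbrs x).image (fun y => (y, x))) fun p hp => ?_
  rcases N.term_delta_eq_zero x p hp with h | h <;> simp [h]

theorem inner_delta (x : V) (f : N.HE) :
    inner ℂ (N.toHE ⟨delta x, N.delta_mem x⟩) f = N.lapHE f x := by
  classical
  obtain ⟨u, rfl⟩ := N.toHE_surjective f
  rw [inner_toHE, lapHE_toHE, tsum_eq_sum
    (s := (N.nbrs x).image (fun y => (x, y)) ∪ (N.nbrs x).image (fun y => (y, x)))
    (fun p hp => by rcases N.term_delta_eq_zero x p hp with h | h <;> simp [term, h])]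
  have hne : ∀ y ∈ N.nbrs x, y ≠ x := fun y hy => (N.mem_nbrs.1 hy).ne'
  rw [Finset.sum_union, Finset.sum_image (by intro a _ b _ h; exact (Prod.mk.inj h).2),
    Finset.sum_image (by intro a _ b _ h; exact (Prod.mk.inj h).1), ← Finset.sum_add_distrib,
    Finset.mul_sum]
  · refine Finset.sum_congr rfl fun y hy => ?_
    simp only [term, delta, if_neg (hne y hy), if_true, N.c_symm y x]
    simp
    ring
  · rw [Finset.disjoint_left]
    intro p h1 h2
    obtain ⟨y, hy, rfl⟩ := Finset.mem_image.1 h1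
    obtain ⟨z, hz, h⟩ := Finset.mem_image.1 h2
    exact hne z hz (Prod.mk.inj h).1

theorem lapHE_dipole (x y : V) : N.lapHE (N.dipole x y) = delta x - delta y := by
  classical
  funext z
  rw [← inner_delta, ← inner_conj_symm, inner_dipole, drop_toHE]
  simp only [delta, Pi.sub_apply, map_sub, apply_ite (starRingEnd ℂ), map_one, map_zero,
    eq_comm (a := z)]

/-- The dense domain `D_E`, the span of the dipoles `v_x = v_{xo}` with `x ≠ o`. -/
def DE (o : V) : Submodule ℂ N.HE :=
  Submodule.span ℂ (Set.range fun x : {x : V // x ≠ o} => N.dipole x o)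

theorem lapHE_mem (o : V) (φ : N.DE o) : N.lapHE φ ∈ N.finiteEnergy := by
  have h : N.DE o ≤ N.finiteEnergy.comap N.lapHE := by
    refine Submodule.span_le.2 ?_
    rintro _ ⟨x, rfl⟩
    simp only [SetLike.mem_coe, Submodule.mem_comap, lapHE_dipole]
    exact sub_mem (N.delta_mem x) (N.delta_mem o)
  exact h φ.2

/-- The graph Laplacian as an operator in `H_E` with domain `D_E`. -/
def lapOp (o : V) : N.HE →ₗ.[ℂ] N.HE where
  domain := N.DE o
  toFun := N.toHE ∘ₗ (N.lapHE ∘ₗ (N.DE o).subtype).codRestrict N.finiteEnergy (N.lapHE_mem o)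

theorem drop_lapOp (o x y : V) (φ : N.DE o) :
    N.drop x y (N.lapOp o φ) = N.lapHE φ x - N.lapHE φ y := rfl

/-- The vector `∑ ξ_x v_x` of `D_E`, for `ξ` finitely supported on `V` without `o`. -/
def dipoleSum (o : V) (ξ : {x : V // x ≠ o} →₀ ℂ) : N.DE o :=
  ⟨ξ.sum fun x a => a • N.dipole x o, Submodule.sum_mem _ fun x _ =>
    Submodule.smul_mem _ _ (Submodule.subset_span ⟨x, rfl⟩)⟩

theorem exists_dipoleSum (o : V) (φ : N.DE o) : ∃ ξ, N.dipoleSum o ξ = φ := by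
  obtain ⟨ξ, hξ⟩ := (Finsupp.mem_span_range_iff_exists_finsupp).1 φ.2
  exact ⟨ξ, Subtype.ext hξ⟩

theorem drop_lapOp_dipoleSum (o : V) (η : {x : V // x ≠ o} →₀ ℂ) (x : {x : V // x ≠ o}) :
    N.drop x o (N.lapOp o (N.dipoleSum o η)) = η x + η.sum fun _ a => a := by
  have h : N.lapHE (N.dipoleSum o η : N.HE)
      = η.sum fun y a => a • (delta (y : V) - delta o) := by
    simp only [dipoleSum, Finsupp.sum, map_sum, map_smul, lapHE_dipole]
  rw [drop_lapOp, h]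
  have hx : ∀ y : {x : V // x ≠ o}, ((x : V) = y) = (y = x) := fun y =>
    propext ⟨fun h => Subtype.ext h.symm, fun h => congrArg Subtype.val h.symm⟩
  have ho : ∀ y : {x : V // x ≠ o}, (o = (y : V)) = False := fun y =>
    eq_false y.2.symm
  simp only [Finsupp.sum, Finset.sum_apply, Pi.smul_apply, Pi.sub_apply, delta, smul_eq_mul, hx,
    ho, if_neg x.2, if_true, if_false, ← Finset.sum_sub_distrib, sub_zero, zero_sub, mul_neg,
    mul_one, sub_neg_eq_add, Finset.sum_add_distrib, mul_ite, mul_zero]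
  congr 1
  rw [Finset.sum_eq_single x (fun y _ hy => if_neg fun h => hy (Subtype.ext h.symm))
    (fun h => by simp [Finsupp.notMem_support_iff.1 h]), if_pos rfl]

theorem inner_lapOp (o : V) (ξ η : {x : V // x ≠ o} →₀ ℂ) :
    inner ℂ (N.dipoleSum o ξ : N.HE) (N.lapOp o (N.dipoleSum o η))
      = (ξ.sum fun x a => starRingEnd ℂ a * η x)
        + starRingEnd ℂ (ξ.sum fun _ a => a) * η.sum fun _ a => a := by
  have h : (N.dipoleSum o ξ : N.HE) = ∑ x ∈ ξ.support, ξ x • N.dipole x o := rfl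
  rw [h, sum_inner]
  simp only [inner_smul_left, inner_dipole, drop_lapOp_dipoleSum, mul_add, Finset.sum_add_distrib,
    Finsupp.sum, map_sum, Finset.sum_mul]

theorem eq_zero_of_drop (o : V) (f : N.HE) (h : ∀ x, N.drop x o f = 0) : f = 0 := by
  obtain ⟨u, rfl⟩ := N.toHE_surjective f
  have hu : ∀ x, u.1 x = u.1 o := fun x => sub_eq_zero.1 (h x)
  rw [← norm_eq_zero, ← sq_eq_zero_iff, @norm_sq_eq_re_inner ℂ, inner_toHE]
  simp [term, hu]

theorem isNonnegSymmetric_lapOp (o : V) : IsNonnegSymmetric (N.lapOp o) where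
  dense := by
    rw [Submodule.dense_iff_topologicalClosure_eq_top, Submodule.topologicalClosure_eq_top_iff,
      Submodule.eq_bot_iff]
    intro f hf
    refine N.eq_zero_of_drop o f fun x => ?_
    rw [← inner_dipole]
    by_cases hx : x = o
    · rw [hx, inner_dipole]
      obtain ⟨u, rfl⟩ := N.toHE_surjective f
      rw [drop_toHE, sub_self]
    · exact (Submodule.mem_orthogonal _ f).1 hf _ (Submodule.subset_span ⟨⟨x, hx⟩, rfl⟩)
  symm φ ψ := by
    obtain ⟨ξ, rfl⟩ := N.exists_dipoleSum o φ
    obtain ⟨η, rfl⟩ := N.exists_dipoleSum o ψ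
    rw [← inner_conj_symm, inner_lapOp, inner_lapOp, map_add, map_mul, Complex.conj_conj,
      mul_comm (η.sum fun _ a => a)]
    congr 1
    classical
    rw [Finsupp.sum_of_support_subset η (Finset.subset_union_right (s₁ := ξ.support)) _ (by simp),
      Finsupp.sum_of_support_subset ξ (Finset.subset_union_left (s₂ := η.support)) _ (by simp),
      map_sum]
    exact Finset.sum_congr rfl fun x _ => by rw [map_mul, Complex.conj_conj, mul_comm]
  nonneg φ := by
    obtain ⟨ξ, rfl⟩ := N.exists_dipoleSum o φ
    rw [inner_lapOp, Complex.add_re, Complex.conj_mul', Finsupp.sum, Complex.re_sum]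
    refine add_nonneg (Finset.sum_nonneg fun x _ => ?_) ?_
    · rw [Complex.conj_mul', ← Complex.ofReal_pow, Complex.ofReal_re]
      positivity
    · rw [← Complex.ofReal_pow, Complex.ofReal_re]
      positivity

/-- The Friedrichs extension `Δ_Fri` of the graph Laplacian with domain `D_E` in `H_E`. -/
def lapFri (o : V) : N.HE →ₗ.[ℂ] N.HE := friedrichs (N.lapOp o) (N.isNonnegSymmetric_lapOp o)

end Network

end

/-! The Friedrichs extension of a nonnegative symmetric `S` is the restriction of the adjoint `S*`
to the form domain (`mem_friedrichsGraph_iff`), so the claim reduces to finding the domain of the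
adjoint of `Δ` on `D_E`. Since `Δ v_x = δ_x - δ_o`, and pairing with `δ_x` evaluates `Δ` at `x`, one
has `⟨Δ v_x, f⟩ = (Δf)(x) - (Δf)(o)` for every `f` in `H_E`, whether or not `Δf` has finite energy.
Hence `w` is the adjoint value at `f` exactly when `w` and `Δf` have the same differences, and such
a `w` in `H_E` exists if and only if `Δf` has finite energy (`exists_adjoint_lapOp_iff`).

The abstract part rests on Cauchy–Schwarz for the form: a form-convergent `ψ_n` has bounded energy,
so replacing `φ_n` by its limit `u` in `⟨φ_n, Sψ_n⟩` costs nothing as `n → ∞`. The explicit form on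
`D_E` is the diagonal case of `inner_lapOp`. -/

/-! ### The Friedrichs extension as a restriction of the adjoint -/

section Friedrichs

variable {H : Type*} [NormedAddCommGroup H] [InnerProductSpace ℂ H]

/-- The quadratic form of a nonnegative symmetric operator as a pre-inner product on its domain. -/
noncomputable abbrev IsNonnegSymmetric.formCore {S : H →ₗ.[ℂ] H} (hS : IsNonnegSymmetric S) :
    PreInnerProductSpace.Core ℂ S.domain where
  inner φ ψ := inner ℂ (φ : H) (S ψ)
  conj_inner_symm φ ψ := by rw [inner_conj_symm, hS.symm]
  re_inner_nonneg φ := hS.nonneg φ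
  add_left φ ψ χ := by rw [Submodule.coe_add, inner_add_left]
  smul_left φ ψ a := by rw [Submodule.coe_smul, inner_smul_left]

/-- Cauchy–Schwarz for a form that may be only semidefinite; symmetry of `S` gives the two
off-diagonal factors the same modulus. -/
theorem IsNonnegSymmetric.norm_form_sq_le {S : H →ₗ.[ℂ] H} (hS : IsNonnegSymmetric S)
    (φ ψ : S.domain) : ‖inner ℂ (φ : H) (S ψ)‖ ^ 2
      ≤ (inner ℂ (φ : H) (S φ)).re * (inner ℂ (ψ : H) (S ψ)).re := by
  have h := @InnerProductSpace.Core.inner_mul_inner_self_le ℂ _ _ _ _ hS.formCore φ ψ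
  have h2 : ‖inner ℂ (ψ : H) (S φ)‖ = ‖inner ℂ (φ : H) (S ψ)‖ := by
    rw [← hS.symm, norm_inner_symm]
  change ‖inner ℂ (φ : H) (S ψ)‖ * ‖inner ℂ (ψ : H) (S φ)‖ ≤ _ at h
  rw [h2, ← sq] at h
  exact h

/-- A Cauchy sequence for the form is bounded in energy: fix `m` with `q(ψ_m - ψ_n) < 1` for all
large `n` and compare `ψ_n` with `ψ_m`. -/
theorem FormConverges.exists_form_le {S : H →ₗ.[ℂ] H} (hS : IsNonnegSymmetric S)
    {ψ : ℕ → S.domain} {v : H} (h : FormConverges S ψ v) :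
    ∃ C : ℝ, 0 ≤ C ∧ ∀ᶠ n in atTop, (inner ℂ (ψ n : H) (S (ψ n))).re ≤ C := by
  have h1 := h.2.eventually (gt_mem_nhds one_pos)
  rw [← prod_atTop_atTop_eq] at h1
  obtain ⟨m, hm⟩ := h1.curry.exists
  have hm' : ∀ᶠ n in atTop,
      (inner ℂ ((ψ m - ψ n : S.domain) : H) (S (ψ m - ψ n))).re < 1 := hm
  refine ⟨2 * (1 + (inner ℂ (ψ m : H) (S (ψ m))).re),
    mul_nonneg zero_le_two (add_nonneg zero_le_one (hS.nonneg _)), ?_⟩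
  filter_upwards [hm'] with n hn
  -- Parallelogram law with `a = ψ_m`, `b = ψ_m - ψ_n`: dropping `q(a + b) ≥ 0` leaves `q(ψ_n) = q(a
  -- - b) ≤ 2 (q(a) + q(b))`.
  have h2 := hS.nonneg (ψ m + (ψ m - ψ n))
  simp only [LinearPMap.map_sub, LinearPMap.map_add, Submodule.coe_sub, Submodule.coe_add,
    inner_sub_left, inner_sub_right, inner_add_left, inner_add_right, Complex.add_re,
    Complex.sub_re] at hn h2 ⊢
  linarith

/-- Along form-convergent sequences, the first argument of the form may be replaced by its limit. -/
theorem FormConverges.tendsto_inner_sub {S : H →ₗ.[ℂ] H} (hS : IsNonnegSymmetric S)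
    {φ ψ : ℕ → S.domain} {u v : H} (hu : FormConverges S φ u) (hv : FormConverges S ψ v) :
    Tendsto (fun n => inner ℂ ((φ n : H) - u) (S (ψ n))) atTop (𝓝 0) := by
  obtain ⟨C, hC, hψ⟩ := hv.exists_form_le hS
  rw [Metric.tendsto_nhds]
  intro ε hε
  -- Chosen so that Cauchy–Schwarz yields `(ε / 2)²`; the denominator is `C + 1` because `C` may
  -- vanish.
  have hδ : 0 < (ε / 2) ^ 2 / (C + 1) := by positivity
  have h1 := hu.2.eventually (gt_mem_nhds hδ)
  rw [← prod_atTop_atTop_eq] at h1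
  filter_upwards [h1.curry, hψ] with n hn hCn
  -- The limit `u` need not lie in the domain of `S`, so the form inequality is applied to `φ_n -
  -- φ_m`. With `n` fixed, `m → ∞` uses only continuity of the inner product of `H`.
  have hlim : Tendsto (fun m => ‖inner ℂ ((φ n : H) - φ m) (S (ψ n))‖) atTop
      (𝓝 ‖inner ℂ ((φ n : H) - u) (S (ψ n))‖) :=
    ((hu.1.const_sub (φ n : H)).inner tendsto_const_nhds).norm
  have hle : ‖inner ℂ ((φ n : H) - u) (S (ψ n))‖ ≤ ε / 2 := by
    refine le_of_tendsto hlim ?_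
    filter_upwards [hn] with m hm
    refine (sq_le_sq₀ (norm_nonneg _) (by positivity)).1 ?_
    calc ‖inner ℂ ((φ n : H) - φ m) (S (ψ n))‖ ^ 2
        ≤ (inner ℂ ((φ n - φ m : S.domain) : H) (S (φ n - φ m))).re
          * (inner ℂ (ψ n : H) (S (ψ n))).re := hS.norm_form_sq_le (φ n - φ m) (ψ n)
      _ ≤ (ε / 2) ^ 2 / (C + 1) * (C + 1) :=
          mul_le_mul hm.le (by linarith) (hS.nonneg _) hδ.le
      _ = (ε / 2) ^ 2 := div_mul_cancel₀ _ (by positivity)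
  rw [dist_zero_right]
  linarith

/-- The Friedrichs extension is the restriction of the adjoint to the form domain. -/
theorem mem_friedrichsGraph_iff (S : H →ₗ.[ℂ] H) (hS : IsNonnegSymmetric S) (u w : H) :
    (u, w) ∈ friedrichsGraph S hS ↔
      u ∈ formDomain S ∧ ∀ ψ : S.domain, inner ℂ u (S ψ) = inner ℂ w (ψ : H) := by
  constructor
  · rintro ⟨φ, hφ, h⟩
    -- Constant sequences are admissible test sequences, and along them `⟨φ_n, Sψ⟩` also tends to
    -- `⟨u, Sψ⟩`.
    exact ⟨⟨φ, hφ⟩, fun ψ => tendsto_nhds_unique (hφ.1.inner tendsto_const_nhds)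
      (h ψ (fun _ => ψ) (FormConverges.const S ψ))⟩
  · rintro ⟨⟨φ, hφ⟩, h⟩
    refine ⟨φ, hφ, fun v ψ hψ => ?_⟩
    have h1 : Tendsto (fun n => inner ℂ w (ψ n : H)) atTop (𝓝 (inner ℂ w v)) :=
      tendsto_const_nhds.inner hψ.1
    -- Split `⟨φ_n, Sψ_n⟩ = ⟨φ_n - u, Sψ_n⟩ + ⟨u, Sψ_n⟩`; the last term equals `⟨w, ψ_n⟩` by
    -- hypothesis.
    have h2 := (hφ.tendsto_inner_sub hS hψ).add h1
    rw [zero_add] at h2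
    refine h2.congr fun n => ?_
    rw [← h, inner_sub_left, sub_add_cancel]

theorem mem_friedrichs_domain_iff (S : H →ₗ.[ℂ] H) (hS : IsNonnegSymmetric S) (u : H) :
    u ∈ (friedrichs S hS).domain ↔
      u ∈ formDomain S ∧ ∃ w : H, ∀ ψ : S.domain, inner ℂ u (S ψ) = inner ℂ w (ψ : H) := by
  rw [LinearPMap.mem_domain_iff]
  simp only [friedrichs_graph, mem_friedrichsGraph_iff, exists_and_left]

end Friedrichs

/-! ### The adjoint of the Laplacian on the span of the dipoles -/

namespace Network

variable {V : Type*} (N : Network V)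

/-- The Laplacian of a dipole is `δ_x - δ_o`, and point masses reproduce values of `Δf`. No energy
bound on `Δf` is needed, which is what lets the adjoint be computed pointwise. -/
theorem inner_lapOp_dipole (o : V) (x : {x : V // x ≠ o}) (f : N.HE) :
    inner ℂ (N.lapOp o ⟨N.dipole x o, Submodule.subset_span ⟨x, rfl⟩⟩) f
      = N.lapHE f x - N.lapHE f o := by
  rw [← inner_delta, ← inner_delta, ← inner_sub_left, ← map_sub]
  exact congrArg (fun g : N.finiteEnergy => inner ℂ (N.toHE g) f)
    (Subtype.ext (N.lapHE_dipole x o))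

/-- `w` is the value at `f` of the adjoint of the Laplacian on `D_E` exactly when the function
`Δf` represents `w` up to a constant. -/
theorem adjoint_lapOp_iff (o : V) (f w : N.HE) :
    (∀ ψ : (N.lapOp o).domain, inner ℂ f (N.lapOp o ψ) = inner ℂ w (ψ : N.HE)) ↔
      ∀ x : V, N.lapHE f x - N.lapHE f o = N.drop x o w := by
  constructor
  · intro h x
    -- No dipole in the spanning set corresponds to `o`, but there both sides vanish.
    by_cases hx : x = o
    · obtain ⟨u, rfl⟩ := N.toHE_surjective w
      rw [hx, sub_self, drop_toHE, sub_self]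
    · rw [← N.inner_lapOp_dipole o ⟨x, hx⟩, ← inner_dipole, ← inner_conj_symm, h, inner_conj_symm]
  · rintro h ⟨ψ, hψ⟩
    refine Submodule.span_induction
      (p := fun ψ hψ => inner ℂ f (N.lapOp o ⟨ψ, hψ⟩) = inner ℂ w ψ) ?_ ?_ ?_ ?_ hψ
    · rintro _ ⟨x, rfl⟩
      rw [← inner_conj_symm, N.inner_lapOp_dipole o x, h, ← inner_dipole, inner_conj_symm]
    · rw [inner_zero_right]
      exact (congrArg (inner ℂ f) (N.lapOp o).map_zero).trans (inner_zero_right f)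
    · intro a b ha hb iha ihb
      rw [inner_add_right, ← iha, ← ihb, ← inner_add_right]
      exact congrArg (inner ℂ f) ((N.lapOp o).map_add ⟨a, ha⟩ ⟨b, hb⟩)
    · intro c a ha iha
      rw [inner_smul_right, ← iha, ← inner_smul_right]
      exact congrArg (inner ℂ f) ((N.lapOp o).map_smul c ⟨a, ha⟩)

theorem const_mem_finiteEnergy (a : ℂ) : (fun _ => a) ∈ N.finiteEnergy := by
  simp [mem_finiteEnergy, summable_zero]

/-- A representative of `w` differs from `Δf` by a constant, which has zero energy; conversely the
class of `Δf` itself serves as `w`. -/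
theorem exists_adjoint_lapOp_iff (o : V) (f : N.HE) :
    (∃ w : N.HE, ∀ ψ : (N.lapOp o).domain, inner ℂ f (N.lapOp o ψ) = inner ℂ w (ψ : N.HE)) ↔
      N.lapHE f ∈ N.finiteEnergy := by
  simp only [adjoint_lapOp_iff]
  constructor
  · rintro ⟨w, hw⟩
    obtain ⟨w, rfl⟩ := N.toHE_surjective w
    have h : N.lapHE f = w.1 + fun _ => N.lapHE f o - w.1 o := by
      funext x
      have := hw x
      rw [drop_toHE] at this
      rw [Pi.add_apply]
      linear_combination this
    rw [h]
    exact add_mem w.2 (N.const_mem_finiteEnergy _)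
  · intro h
    exact ⟨N.toHE ⟨_, h⟩, fun x => (N.drop_toHE x o ⟨_, h⟩).symm⟩

theorem mem_lapFri_domain_iff (o : V) (f : N.HE) :
    f ∈ (N.lapFri o).domain ↔ f ∈ formDomain (N.lapOp o) ∧ N.lapHE f ∈ N.finiteEnergy := by
  rw [lapFri, mem_friedrichs_domain_iff, exists_adjoint_lapOp_iff]

theorem inner_lapOp_self (o : V) (ξ : {x : V // x ≠ o} →₀ ℂ) :
    inner ℂ (N.dipoleSum o ξ : N.HE) (N.lapOp o (N.dipoleSum o ξ)) =
      (((ξ.sum fun _ a => ‖a‖ ^ 2) + ‖ξ.sum fun _ a => a‖ ^ 2 : ℝ) : ℂ) := by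
  simp only [inner_lapOp, Complex.conj_mul', Finsupp.sum]
  push_cast
  rfl

end Network

theorem lemma6p5 {V : Type*} [Countable V] (N : Network V) (o : V) :
    (∀ u : V → ℂ,
      (∃ hu : u ∈ N.finiteEnergy, N.toHE ⟨u, hu⟩ ∈ (N.lapFri o).domain) ↔
        (∃ hu : u ∈ N.finiteEnergy, N.toHE ⟨u, hu⟩ ∈ formDomain (N.lapOp o)) ∧
          N.lap u ∈ N.finiteEnergy) ∧
    (∀ ξ : {x : V // x ≠ o} →₀ ℂ,
      inner ℂ (N.dipoleSum o ξ : N.HE) (N.lapOp o (N.dipoleSum o ξ)) =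
        (((ξ.sum fun _ a => ‖a‖ ^ 2) + ‖ξ.sum fun _ a => a‖ ^ 2 : ℝ) : ℂ)) ∧
    (∀ ξ : {x : V // x ≠ o} →₀ ℂ, (ξ.sum fun _ a => a) = 0 →
      inner ℂ (N.dipoleSum o ξ : N.HE) (N.lapOp o (N.dipoleSum o ξ)) =
        ((ξ.sum fun _ a => ‖a‖ ^ 2 : ℝ) : ℂ)) := by
  refine ⟨fun u => ?_, N.inner_lapOp_self o, fun ξ hξ => ?_⟩
  -- The energy condition on `Δu` does not involve the proof that `u` has finite energy, so it
  -- leaves the existential.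
  · simp only [Network.mem_lapFri_domain_iff, Network.lapHE_toHE, exists_and_right]
  · rw [N.inner_lapOp_self, hξ]
    simp
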